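/- Let $\mathcal H$ be a real Hilbert space, let $m\ge 1$, let $M_1,\dots,M_m$ be closed linear subspaces of $\mathcal H$, and let $M=\bigcap_{i=1}^m M_i$. Denote by $P_K$ the orthogonal projection onto a closed subspace $K$ and by $d(x,K)$ the distance from $x$ to $K$. For $y_0\in\mathcal H$ let $y_k=(P_{M_m}\cdots P_{M_1})^k y_0$, $k=1,2,\dots$. All rates are as $k\to\infty$, with implied constants that may depend on $y_0$. (1) For each $y_0\in\mathcal H$, $$\|y_k-y_{k-1}\|=o(k^{-1})\qquad\text{and}\qquad \sqrt{\tfrac1m\sum_{i=1}^m d^2(y_k,M_i)}=o(k^{-1/2}).$$ (2) For each $y_0\in Y:=M\oplus\sum_{i=1}^m M_i^\perp$ (algebraic sum, no closure taken), $$\|y_k-P_My_0\|=O(k^{-1/2}),\qquad \|y_k-y_{k-1}\|=O(k^{-3/2}),\qquad \sqrt{\tfrac1m\sum_{i=1}^m d^2(y_k,M_i)}=O(k^{-1}).$$ (3) If $\sum_{i=1}^m M_i^\perp$ is not closed in $\mathcal H$, then none of these five exponents can be improved: for every $\varepsilon>0$, - there is $y_0\in\mathcal H$ for which $\|y_k-y_{k-1}\|$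 is not $O(k^{-1-\varepsilon})$; - there is $y_0\in\mathcal H$ for which $\sqrt{\frac1m\sum_{i=1}^m d^2(y_k,M_i)}$ is not $O(k^{-1/2-\varepsilon})$; - there is $y_0\in Y$ for which $\|y_k-P_My_0\|$ is not $O(k^{-1/2-\varepsilon})$; - there is $y_0\in Y$ for which $\|y_k-y_{k-1}\|$ is not $O(k^{-3/2-\varepsilon})$; - there is $y_0\in Y$ for which $\sqrt{\frac1m\sum_{i=1}^m d^2(y_k,M_i)}$ is not $O(k^{-1-\varepsilon})$. -/

import Mathlib

open Filter Topology Asymptotics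

noncomputable section

variable {H : Type*} [NormedAddCommGroup H] [InnerProductSpace ℝ H] [CompleteSpace H]

/-- The orthogonal projection of a Hilbert space onto a closed linear subspace, as a bounded
operator of the whole space. -/
def orthProj (K : ClosedSubmodule ℝ H) : H →L[ℝ] H :=
  haveI : CompleteSpace K.toSubmodule := K.isClosed.completeSpace_coe
  K.toSubmodule.starProjection

/-- The operator `P_{M_m} ⋯ P_{M_1}` (the projection onto the first subspace acts first;
multiplication of operators is composition). -/
def cyclicOp {m : ℕ} (M : Fin m → ClosedSubmodule ℝ H) : H →L[ℝ] H :=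
  (List.ofFn fun i => orthProj (M i)).reverse.prod

/-- The method of cyclic projections: `y_k = (P_{M_m} ⋯ P_{M_1})^k y_0`. -/
def cyclicSeq {m : ℕ} (M : Fin m → ClosedSubmodule ℝ H) (y₀ : H) (k : ℕ) : H :=
  (cyclicOp M ^ k) y₀

/-- The average distance `√((1/m) ∑ d²(x, M_i))` of a point to the subspaces. -/
def avgDist {m : ℕ} (M : Fin m → ClosedSubmodule ℝ H) (x : H) : ℝ :=
  Real.sqrt ((1 / (m : ℝ)) * ∑ i, Metric.infDist x (M i : Set H) ^ 2)

/-- The algebraic sum `∑ M_i^⊥` of the orthogonal complements (no closure is taken). -/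
def sumPerp {m : ℕ} (M : Fin m → ClosedSubmodule ℝ H) : Submodule ℝ H :=
  ⨆ i, (M i).toSubmoduleᗮ

/-- The subspace `Y = M ⊕ ∑ M_i^⊥`, where `M = ⋂ M_i`. -/
def startSpace {m : ℕ} (M : Fin m → ClosedSubmodule ℝ H) : Submodule ℝ H :=
  (⨅ i, M i).toSubmodule ⊔ sumPerp M

end

/-! Write `T` for the product of projections, `D x` for the sum of squared distances to the `M i`,
and `q x = ‖x‖² - ‖T x‖²`. Pythagoras along one sweep gives two estimates: `D x ≤ m² q x`, and the
sectoriality bound `⟨x - T x, y⟩² ≤ q x * D y`. Together they yield `‖u - T u‖⁴ ≤ m² q u * q (u - T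
u)`, from which induction gives the Ritt bound `k ‖T ^ k (x - T x)‖ ≤ m ‖x‖`. Since `q x ≤ 2 ⟨x - T
x, x⟩`, it follows that `D (T ^ k x) = O(1/k)`.

The adjoint of `T` is the product in reverse order, so this decay dualizes to `‖T ^ k w‖ =
O(k^(-1/2))` for `w` in some `(M i)ᗮ`, hence on their sum, and by density `T ^ k → 0` strongly on
`Mᗮ`. Splitting `T ^ k` into two halves multiplies this decay by the Ritt factor `1/k`, which gives
the rates for increments; `D (T ^ k x) ≤ 2 m² ‖T ^ k (x - T x)‖ ‖T ^ k x‖` gives those for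
distances.

For optimality, a better rate at every starting point is uniform by Banach–Steinhaus. Summing the
decrements of `‖T ^ k x‖` or of its square, some power of `T` becomes a strict contraction on `Mᗮ`;
a Neumann series then writes each `z ∈ Mᗮ` as `x - T ^ N x`, which lies in the sum of the
complements, so that sum is closed. On `Y`, a better rate for the error is dual to a uniform rate
for distances in the reversed order, and better rates for increments or distances imply one for the
error. -/

theorem norm_sq_sub_norm_sq_apply {H : Type*} [NormedAddCommGroup H] [InnerProductSpace ℝ H]
    (T : H →L[ℝ] H) (x : H) :
    ‖x‖ ^ 2 - ‖T x‖ ^ 2 = 2 * inner ℝ (x - T x) x - ‖x - T x‖ ^ 2 := by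
  rw [norm_sub_sq_real, inner_sub_left, real_inner_self_eq_norm_sq, real_inner_comm]
  ring

/-! ### Orthogonal projections and distances -/

section Projection

variable {H : Type*} [NormedAddCommGroup H] [InnerProductSpace ℝ H] [CompleteSpace H]

theorem orthProj_mem (K : ClosedSubmodule ℝ H) (x : H) : orthProj K x ∈ K := by
  have : CompleteSpace K.toSubmodule := K.isClosed.completeSpace_coe
  exact K.toSubmodule.starProjection_apply_mem x

theorem sub_orthProj_mem (K : ClosedSubmodule ℝ H) (x : H) :
    x - orthProj K x ∈ K.toSubmoduleᗮ := by
  have : CompleteSpace K.toSubmodule := K.isClosed.completeSpace_coe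
  exact K.toSubmodule.sub_starProjection_mem_orthogonal x

theorem orthProj_eq_self {K : ClosedSubmodule ℝ H} {x : H} (hx : x ∈ K) : orthProj K x = x := by
  have : CompleteSpace K.toSubmodule := K.isClosed.completeSpace_coe
  exact Submodule.starProjection_eq_self_iff.2 hx

theorem orthProj_eq_zero {K : ClosedSubmodule ℝ H} {x : H} (hx : x ∈ K.toSubmoduleᗮ) :
    orthProj K x = 0 := by
  have : CompleteSpace K.toSubmodule := K.isClosed.completeSpace_coe
  exact (Submodule.starProjection_apply_eq_zero_iff _).2 hx

theorem orthProj_isSelfAdjoint (K : ClosedSubmodule ℝ H) : IsSelfAdjoint (orthProj K) := by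
  have : CompleteSpace K.toSubmodule := K.isClosed.completeSpace_coe
  exact isSelfAdjoint_starProjection K.toSubmodule

theorem norm_sub_orthProj_le (K : ClosedSubmodule ℝ H) (x : H) {y : H} (hy : y ∈ K) :
    ‖x - orthProj K x‖ ≤ ‖x - y‖ := by
  have : CompleteSpace K.toSubmodule := K.isClosed.completeSpace_coe
  have h := K.toSubmodule.starProjection_minimal x
  change ‖x - K.toSubmodule.starProjection x‖ ≤ _
  rw [h]
  exact ciInf_le ⟨0, by rintro _ ⟨z, rfl⟩; exact norm_nonneg _⟩ (⟨y, hy⟩ : K.toSubmodule)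

theorem norm_sub_orthProj_le_norm (K : ClosedSubmodule ℝ H) (x : H) :
    ‖x - orthProj K x‖ ≤ ‖x‖ := by
  simpa using norm_sub_orthProj_le K x K.toSubmodule.zero_mem

theorem infDist_eq_norm_sub_orthProj (K : ClosedSubmodule ℝ H) (x : H) :
    Metric.infDist x (K : Set H) = ‖x - orthProj K x‖ := by
  apply le_antisymm
  · rw [← dist_eq_norm]
    exact Metric.infDist_le_dist_of_mem (orthProj_mem K x)
  · refine (Metric.le_infDist (s := (K : Set H)) ⟨0, K.toSubmodule.zero_mem⟩).2 fun y hy => ?_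
    rw [dist_eq_norm]
    exact norm_sub_orthProj_le K x hy

theorem inner_sub_orthProj_orthProj (K : ClosedSubmodule ℝ H) (x y : H) :
    inner ℝ (x - orthProj K x) (orthProj K y) = 0 := by
  rw [real_inner_comm]
  exact sub_orthProj_mem K x _ (orthProj_mem K y)

theorem norm_sq_orthProj (K : ClosedSubmodule ℝ H) (x : H) :
    ‖x‖ ^ 2 = ‖x - orthProj K x‖ ^ 2 + ‖orthProj K x‖ ^ 2 := by
  have h := norm_add_sq_real (x - orthProj K x) (orthProj K x)
  rw [inner_sub_orthProj_orthProj, sub_add_cancel] at h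
  linarith

/-- The sum of the squared distances of a point to finitely many subspaces. -/
noncomputable def sumSqDist {m : ℕ} (M : Fin m → ClosedSubmodule ℝ H) (x : H) : ℝ :=
  ∑ i, ‖x - orthProj (M i) x‖ ^ 2

theorem sumSqDist_nonneg {m : ℕ} (M : Fin m → ClosedSubmodule ℝ H) (x : H) :
    0 ≤ sumSqDist M x :=
  Finset.sum_nonneg fun _ _ => sq_nonneg _

theorem norm_sub_sq_le_sumSqDist {m : ℕ} (M : Fin m → ClosedSubmodule ℝ H) (i : Fin m) (x : H) :
    ‖x - orthProj (M i) x‖ ^ 2 ≤ sumSqDist M x :=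
  Finset.single_le_sum (f := fun i => ‖x - orthProj (M i) x‖ ^ 2) (fun _ _ => sq_nonneg _)
    (Finset.mem_univ i)

theorem avgDist_sq {m : ℕ} (M : Fin m → ClosedSubmodule ℝ H) (x : H) :
    avgDist M x ^ 2 = 1 / (m : ℝ) * sumSqDist M x := by
  rw [avgDist, Real.sq_sqrt]
  · simp only [infDist_eq_norm_sub_orthProj, sumSqDist]
  · positivity

end Projection

/-! ### One sweep: energy and sectoriality estimates -/

section CyclicOp

variable {H : Type*} [NormedAddCommGroup H] [InnerProductSpace ℝ H] [CompleteSpace H]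

theorem cyclicOp_zero (M : Fin 0 → ClosedSubmodule ℝ H) : cyclicOp M = 1 := by
  simp [cyclicOp]

theorem cyclicOp_succ {m : ℕ} (M : Fin (m + 1) → ClosedSubmodule ℝ H) :
    cyclicOp M = cyclicOp (fun i => M i.succ) * orthProj (M 0) := by
  simp [cyclicOp, List.ofFn_succ]

theorem cyclicOp_succ_last {m : ℕ} (M : Fin (m + 1) → ClosedSubmodule ℝ H) :
    cyclicOp M = orthProj (M (Fin.last m)) * cyclicOp (fun i => M i.castSucc) := by
  simp only [cyclicOp, List.ofFn_succ', List.concat_eq_append, List.reverse_append,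
    List.reverse_singleton, List.singleton_append, List.prod_cons]

theorem cyclicOp_succ_apply {m : ℕ} (M : Fin (m + 1) → ClosedSubmodule ℝ H) (x : H) :
    cyclicOp M x = cyclicOp (fun i => M i.succ) (orthProj (M 0) x) := by
  rw [cyclicOp_succ]; rfl

theorem star_cyclicOp {m : ℕ} (M : Fin m → ClosedSubmodule ℝ H) :
    star (cyclicOp M) = cyclicOp (fun i => M i.rev) := by
  induction m with
  | zero => simp [cyclicOp_zero]
  | succ m ih =>
    rw [cyclicOp_succ, star_mul, ih, cyclicOp_succ_last (fun i => M i.rev),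
      (orthProj_isSelfAdjoint _).star_eq]
    simp only [Fin.rev_last, Fin.rev_castSucc]

theorem cyclicOp_apply_of_mem {m : ℕ} (M : Fin m → ClosedSubmodule ℝ H) {x : H}
    (hx : ∀ i, x ∈ M i) : cyclicOp M x = x := by
  induction m with
  | zero => simp [cyclicOp_zero]
  | succ m ih =>
    rw [cyclicOp_succ_apply, orthProj_eq_self (hx 0), ih _ fun i => hx i.succ]

/-- Each projection in the sweep moves the point by an element of the corresponding complement. -/
theorem sub_cyclicOp_mem_sumPerp {m : ℕ} (M : Fin m → ClosedSubmodule ℝ H) (x : H) :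
    x - cyclicOp M x ∈ sumPerp M := by
  induction m generalizing x with
  | zero => simp [cyclicOp_zero]
  | succ m ih =>
    rw [cyclicOp_succ_apply, ← sub_add_sub_cancel x (orthProj (M 0) x)]
    refine add_mem (Submodule.mem_iSup_of_mem 0 (sub_orthProj_mem _ _)) ?_
    have hle : sumPerp (fun i => M i.succ) ≤ sumPerp M :=
      iSup_le fun i => le_iSup (fun i => (M i).toSubmoduleᗮ) i.succ
    exact hle (ih _ _)

/-- One sweep decreases the squared norm by a fixed multiple of each squared distance. -/
theorem norm_sub_orthProj_sq_le {m : ℕ} (M : Fin m → ClosedSubmodule ℝ H) (x : H) (i : Fin m) :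
    ‖x - orthProj (M i) x‖ ^ 2 ≤ m * (‖x‖ ^ 2 - ‖cyclicOp M x‖ ^ 2) := by
  induction m generalizing x with
  | zero => exact i.elim0
  | succ m ih =>
    rw [cyclicOp_succ_apply]
    set z := orthProj (M 0) x with hz
    have hpyth := norm_sq_orthProj (M 0) x
    rw [← hz] at hpyth
    have hdec : 0 ≤ ‖z‖ ^ 2 - ‖cyclicOp (fun i => M i.succ) z‖ ^ 2 := by
      rcases m.eq_zero_or_pos with rfl | hm
      · simp [cyclicOp_zero]
      · have := (sq_nonneg _).trans (ih (fun i => M i.succ) z ⟨0, hm⟩)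
        exact nonneg_of_mul_nonneg_right this (by exact_mod_cast hm)
    set q := ‖z‖ ^ 2 - ‖cyclicOp (fun i => M i.succ) z‖ ^ 2 with hq
    have hm0 : (0 : ℝ) ≤ m := Nat.cast_nonneg m
    -- Here `b` bounds the distance from `z` to `M i`. From `b² ≤ m q` and `2ab ≤ m a² + q` follows
    -- `(a + b)² ≤ (m + 1)(a² + q)`, with `a = ‖x - z‖`.
    have key : ∀ b : ℝ, 0 ≤ b → b ^ 2 ≤ m * q → ‖x - orthProj (M i) x‖ ≤ ‖x - z‖ + b →
        ‖x - orthProj (M i) x‖ ^ 2 ≤ (m + 1) * (‖x - z‖ ^ 2 + q) := by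
      intro b hb hbq hle
      have h2 : 2 * ‖x - z‖ * b ≤ m * ‖x - z‖ ^ 2 + q := by
        refine abs_le_of_sq_le_sq' ?_ (by positivity) |>.2
        nlinarith [sq_nonneg (m * ‖x - z‖ ^ 2 - q), sq_nonneg ‖x - z‖,
          mul_le_mul_of_nonneg_left hbq (sq_nonneg ‖x - z‖)]
      have h3 : ‖x - orthProj (M i) x‖ ^ 2 ≤ (‖x - z‖ + b) ^ 2 :=
        pow_le_pow_left₀ (norm_nonneg _) hle 2
      nlinarith
    have hres : ‖x - orthProj (M i) x‖ ^ 2 ≤ (m + 1) * (‖x - z‖ ^ 2 + q) := by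
      refine Fin.cases (fun key => ?_) (fun j key => ?_) i key
      · exact key 0 le_rfl (by simpa using mul_nonneg hm0 hdec) (by simp [hz])
      · refine key ‖z - orthProj (M j.succ) z‖ (norm_nonneg _)
          (ih (fun i => M i.succ) z j) ?_
        refine (norm_sub_orthProj_le _ x (orthProj_mem _ z)).trans ?_
        exact norm_sub_le_norm_sub_add_norm_sub _ _ _
    push_cast
    convert hres using 2
    linarith

theorem norm_cyclicOp_apply_le {m : ℕ} (M : Fin m → ClosedSubmodule ℝ H) (x : H) :
    ‖cyclicOp M x‖ ≤ ‖x‖ := by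
  rcases m.eq_zero_or_pos with rfl | hm
  · simp [cyclicOp_zero]
  · have h1 := (sq_nonneg _).trans (norm_sub_orthProj_sq_le M x ⟨0, hm⟩)
    have h2 := nonneg_of_mul_nonneg_right h1 (by exact_mod_cast hm)
    exact abs_le_of_sq_le_sq' (by linarith) (norm_nonneg _) |>.2

theorem sumSqDist_le {m : ℕ} (M : Fin m → ClosedSubmodule ℝ H) (x : H) :
    sumSqDist M x ≤ m ^ 2 * (‖x‖ ^ 2 - ‖cyclicOp M x‖ ^ 2) := by
  refine (Finset.sum_le_sum fun i _ => norm_sub_orthProj_sq_le M x i).trans_eq ?_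
  rw [Finset.sum_const, Finset.card_univ, Fintype.card_fin, nsmul_eq_mul]
  ring

/-- A sectoriality estimate for `1 - T`, where `T` is a product of projections. -/
theorem inner_sub_cyclicOp_sq_le {m : ℕ} (M : Fin m → ClosedSubmodule ℝ H) (x y : H) :
    (inner ℝ (x - cyclicOp M x) y) ^ 2 ≤ (‖x‖ ^ 2 - ‖cyclicOp M x‖ ^ 2) * sumSqDist M y := by
  induction m generalizing x with
  | zero => simp [cyclicOp_zero]
  | succ m ih =>
    have hD : sumSqDist M y = ‖y - orthProj (M 0) y‖ ^ 2 + sumSqDist (fun i => M i.succ) y := by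
      simp [sumSqDist, Fin.sum_univ_succ]
    rw [cyclicOp_succ_apply, hD]
    set z := orthProj (M 0) x with hz
    have hpyth := norm_sq_orthProj (M 0) x
    rw [← hz] at hpyth
    -- The displacement `x - z` is orthogonal to `M 0`, so it sees only the component of `y` off `M
    -- 0`.
    have h1 : inner ℝ (x - z) y = inner ℝ (x - z) (y - orthProj (M 0) y) := by
      rw [inner_sub_right, hz, inner_sub_orthProj_orthProj, sub_zero]
    have h2 : |inner ℝ (x - z) y| ≤ ‖x - z‖ * ‖y - orthProj (M 0) y‖ := by
      rw [h1]; exact abs_real_inner_le_norm _ _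
    have hdec : 0 ≤ ‖z‖ ^ 2 - ‖cyclicOp (fun i => M i.succ) z‖ ^ 2 := by
      have := pow_le_pow_left₀ (norm_nonneg _) (norm_cyclicOp_apply_le (fun i => M i.succ) z) 2
      linarith
    have hih := ih (fun i => M i.succ) z
    have hD0 := sumSqDist_nonneg (fun i => M i.succ) y
    rw [← sub_add_sub_cancel x z, inner_add_left]
    set q := ‖z‖ ^ 2 - ‖cyclicOp (fun i => M i.succ) z‖ ^ 2 with hq
    set D := sumSqDist (fun i => M i.succ) y
    have h3 : |inner ℝ (z - cyclicOp (fun i => M i.succ) z) y| ≤ √q * √D := by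
      rw [← Real.sqrt_mul hdec]
      exact Real.abs_le_sqrt hih
    have h4 := abs_add_le (inner ℝ (x - z) y) (inner ℝ (z - cyclicOp (fun i => M i.succ) z) y)
    have hq2 := Real.sq_sqrt hdec
    have hD2 := Real.sq_sqrt hD0
    have hx : ‖x‖ ^ 2 - ‖cyclicOp (fun i => M i.succ) z‖ ^ 2 = ‖x - z‖ ^ 2 + √q ^ 2 := by
      rw [hq2]; linarith
    rw [hx, ← hD2, ← sq_abs]
    refine (pow_le_pow_left₀ (abs_nonneg _) (h4.trans (add_le_add h2 h3)) 2).trans ?_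
    -- Cauchy–Schwarz in the plane.
    nlinarith [sq_nonneg (‖x - z‖ * √D - √q * ‖y - orthProj (M 0) y‖)]

/-- Sectoriality with `y = x` gives `q ≤ 2 √(q D)`, whence the constant 4. This converse of
`sumSqDist_le` turns rates for distances into rates for norms. -/
theorem norm_sq_sub_le_sumSqDist {m : ℕ} (M : Fin m → ClosedSubmodule ℝ H) (x : H) :
    ‖x‖ ^ 2 - ‖cyclicOp M x‖ ^ 2 ≤ 4 * sumSqDist M x := by
  have h1 := norm_sq_sub_norm_sq_apply (cyclicOp M) x
  have h2 := inner_sub_cyclicOp_sq_le M x x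
  have h3 := sumSqDist_nonneg M x
  have h4 := sq_nonneg ‖x - cyclicOp M x‖
  set q := ‖x‖ ^ 2 - ‖cyclicOp M x‖ ^ 2
  by_contra! h
  nlinarith

theorem sumSqDist_le_inner {m : ℕ} (M : Fin m → ClosedSubmodule ℝ H) (x : H) :
    sumSqDist M x ≤ 2 * m ^ 2 * (‖x - cyclicOp M x‖ * ‖x‖) := by
  have h1 := norm_sq_sub_norm_sq_apply (cyclicOp M) x
  have h2 := real_inner_le_norm (x - cyclicOp M x) x
  have h4 := sq_nonneg ‖x - cyclicOp M x‖
  have h5 := sumSqDist_le M x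
  have : ‖x‖ ^ 2 - ‖cyclicOp M x‖ ^ 2 ≤ 2 * (‖x - cyclicOp M x‖ * ‖x‖) := by linarith
  nlinarith [mul_le_mul_of_nonneg_left this (sq_nonneg (m : ℝ))]

end CyclicOp

/-! ### Powers of the cyclic operator: the Ritt bound and duality -/

section Powers

variable {H : Type*} [NormedAddCommGroup H] [InnerProductSpace ℝ H] [CompleteSpace H]
  {m : ℕ} (M : Fin m → ClosedSubmodule ℝ H)

theorem norm_cyclicOp_pow_apply_le (k : ℕ) (x : H) : ‖(cyclicOp M ^ k) x‖ ≤ ‖x‖ := by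
  induction k with
  | zero => simp
  | succ k ih =>
    rw [pow_succ', mul_apply_eq_comp]
    exact (norm_cyclicOp_apply_le M _).trans ih

theorem cyclicOp_pow_apply_of_mem {x : H} (hx : x ∈ ⨅ i, M i) (k : ℕ) :
    (cyclicOp M ^ k) x = x := by
  induction k with
  | zero => simp
  | succ k ih =>
    rw [pow_succ', mul_apply_eq_comp, ih,
      cyclicOp_apply_of_mem M (ClosedSubmodule.mem_iInf.1 hx)]

theorem cyclicOp_pow_sub (k : ℕ) (x : H) :
    (cyclicOp M ^ k) (x - cyclicOp M x) = (cyclicOp M ^ k) x - cyclicOp M ((cyclicOp M ^ k) x) := by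
  rw [map_sub, ← mul_apply_eq_comp, ← mul_apply_eq_comp, ← pow_succ,
    pow_succ']

/-- A product of projections is a Ritt operator. -/
theorem sq_mul_norm_cyclicOp_pow_sub_sq_le (k : ℕ) (x : H) :
    (k : ℝ) ^ 2 * ‖(cyclicOp M ^ k) (x - cyclicOp M x)‖ ^ 2 ≤
      m ^ 2 * (‖x‖ ^ 2 - ‖(cyclicOp M ^ k) x‖ ^ 2) := by
  induction k with
  | zero => simp
  | succ k ih =>
    set u := (cyclicOp M ^ k) x with hu
    set v := (cyclicOp M ^ k) (x - cyclicOp M x) with hv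
    have hvu : v = u - cyclicOp M u := cyclicOp_pow_sub M k x
    rw [pow_succ' (cyclicOp M) k, mul_apply_eq_comp,
      mul_apply_eq_comp, ← hu, ← hv]
    have h1 := inner_sub_cyclicOp_sq_le M u v
    rw [← hvu, real_inner_self_eq_norm_sq] at h1
    have hq : 0 ≤ ‖u‖ ^ 2 - ‖cyclicOp M u‖ ^ 2 :=
      sub_nonneg.2 (pow_le_pow_left₀ (norm_nonneg _) (norm_cyclicOp_apply_le M u) 2)
    have hp : 0 ≤ ‖v‖ ^ 2 - ‖cyclicOp M v‖ ^ 2 :=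
      sub_nonneg.2 (pow_le_pow_left₀ (norm_nonneg _) (norm_cyclicOp_apply_le M v) 2)
    have h2 := h1.trans (mul_le_mul_of_nonneg_left (sumSqDist_le M v) hq)
    set q := ‖u‖ ^ 2 - ‖cyclicOp M u‖ ^ 2
    set p := ‖v‖ ^ 2 - ‖cyclicOp M v‖ ^ 2 with hpdef
    have hk : (0 : ℝ) ≤ k := Nat.cast_nonneg k
    -- AM-GM applied to `‖v‖⁴ ≤ m² q p`, weighted so that `(k + 1)² p` pays for the growth of the
    -- factor from `k²` to `(k + 1)²`.
    have h3 : 2 * (k + 1) * ‖v‖ ^ 2 ≤ ((k : ℝ) + 1) ^ 2 * p + m ^ 2 * q := by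
      refine abs_le_of_sq_le_sq' ?_ (by positivity) |>.2
      nlinarith [sq_nonneg (((k : ℝ) + 1) ^ 2 * p - m ^ 2 * q),
        mul_le_mul_of_nonneg_left h2 (sq_nonneg ((k : ℝ) + 1))]
    have h4 : ‖cyclicOp M v‖ ^ 2 = ‖v‖ ^ 2 - p := by rw [hpdef]; ring
    have h5 : ‖cyclicOp M u‖ ^ 2 = ‖u‖ ^ 2 - q := by simp [q]
    rw [h4, h5]
    push_cast
    nlinarith [sq_nonneg ‖v‖]

theorem mul_norm_cyclicOp_pow_sub_le (k : ℕ) (x : H) :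
    (k : ℝ) * ‖(cyclicOp M ^ k) (x - cyclicOp M x)‖ ≤ m * ‖x‖ := by
  refine abs_le_of_sq_le_sq' ?_ (by positivity) |>.2
  have h1 := sq_mul_norm_cyclicOp_pow_sub_sq_le M k x
  have h2 := mul_nonneg (sq_nonneg (m : ℝ)) (sq_nonneg ‖(cyclicOp M ^ k) x‖)
  rw [mul_pow, mul_pow]
  linarith

theorem sumSqDist_cyclicOp_pow_le (k : ℕ) (x : H) :
    sumSqDist M ((cyclicOp M ^ k) x) ≤
      2 * m ^ 2 * (‖(cyclicOp M ^ k) (x - cyclicOp M x)‖ * ‖(cyclicOp M ^ k) x‖) := by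
  rw [cyclicOp_pow_sub]
  exact sumSqDist_le_inner M _

theorem mul_sumSqDist_cyclicOp_pow_le (k : ℕ) (x : H) :
    (k : ℝ) * sumSqDist M ((cyclicOp M ^ k) x) ≤ 2 * m ^ 3 * ‖x‖ ^ 2 := by
  have h1 := sumSqDist_cyclicOp_pow_le M k x
  have h2 := mul_norm_cyclicOp_pow_sub_le M k x
  have h3 := norm_cyclicOp_pow_apply_le M k x
  set a := ‖(cyclicOp M ^ k) (x - cyclicOp M x)‖
  set b := ‖(cyclicOp M ^ k) x‖
  have hb : 0 ≤ b := norm_nonneg _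
  calc (k : ℝ) * sumSqDist M ((cyclicOp M ^ k) x) ≤ k * (2 * m ^ 2 * (a * b)) := by gcongr
    _ = 2 * m ^ 2 * ((k * a) * b) := by ring
    _ ≤ 2 * m ^ 2 * ((m * ‖x‖) * ‖x‖) := by gcongr
    _ = _ := by ring

theorem adjoint_cyclicOp_pow (k : ℕ) :
    ContinuousLinearMap.adjoint (cyclicOp M ^ k) = cyclicOp (fun i => M i.rev) ^ k := by
  rw [← ContinuousLinearMap.star_eq_adjoint, star_pow, star_cyclicOp]

/-- Duality: `‖z‖² = ⟨w, S ^ k z⟩` for `z = T ^ k w` and `S` the adjoint of `T`. As `w ⊥ M i`, only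
the distance from `S ^ k z` to `M i` contributes, and it is `O(k^(-1/2)) ‖z‖`. -/
theorem mul_norm_cyclicOp_pow_sq_le_of_mem_orthogonal {i : Fin m} {w : H}
    (hw : w ∈ (M i).toSubmoduleᗮ) (k : ℕ) :
    (k : ℝ) * ‖(cyclicOp M ^ k) w‖ ^ 2 ≤ 2 * m ^ 3 * ‖w‖ ^ 2 := by
  set z := (cyclicOp M ^ k) w with hz
  set S := cyclicOp (fun i => M i.rev) with hS
  have h1 : ‖z‖ ^ 2 = inner ℝ w ((S ^ k) z - orthProj (M i) ((S ^ k) z)) := by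
    rw [inner_sub_right, Submodule.inner_left_of_mem_orthogonal (orthProj_mem (M i) _) hw,
      sub_zero, ← adjoint_cyclicOp_pow,
      ContinuousLinearMap.adjoint_inner_right, ← hz, real_inner_self_eq_norm_sq]
  have h2 := real_inner_le_norm w ((S ^ k) z - orthProj (M i) ((S ^ k) z))
  rw [← h1] at h2
  have h3 := norm_sub_sq_le_sumSqDist (fun i => M i.rev) i.rev ((S ^ k) z)
  rw [Fin.rev_rev] at h3
  have h4 := mul_sumSqDist_cyclicOp_pow_le (fun i => M i.rev) k z
  set d := ‖(S ^ k) z - orthProj (M i) ((S ^ k) z)‖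
  have hk : (0 : ℝ) ≤ k := Nat.cast_nonneg k
  rcases (sq_nonneg ‖z‖).eq_or_lt with h0 | h0
  · rw [← h0]; simp; positivity
  have h5 : (‖z‖ ^ 2) ^ 2 ≤ ‖w‖ ^ 2 * d ^ 2 := by
    rw [← mul_pow]; exact pow_le_pow_left₀ h0.le h2 2
  have h6 : (k : ℝ) * d ^ 2 ≤ 2 * m ^ 3 * ‖z‖ ^ 2 :=
    (mul_le_mul_of_nonneg_left h3 hk).trans h4
  refine le_of_mul_le_mul_right ?_ h0
  nlinarith [mul_le_mul_of_nonneg_left h5 hk, mul_le_mul_of_nonneg_left h6 (sq_nonneg ‖w‖)]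

end Powers

/-! ### The sum of the complements and its closedness -/

section SumPerp

variable {H : Type*} [NormedAddCommGroup H] [InnerProductSpace ℝ H] [CompleteSpace H]
  {m : ℕ} (M : Fin m → ClosedSubmodule ℝ H)

theorem sumPerp_comp_rev {H : Type*} [NormedAddCommGroup H] [InnerProductSpace ℝ H] {m : ℕ}
    (M : Fin m → ClosedSubmodule ℝ H) : sumPerp (fun i => M i.rev) = sumPerp M :=
  Fin.revPerm.iSup_comp (g := fun i => (M i).toSubmoduleᗮ)

theorem orthogonal_sumPerp : (sumPerp M)ᗮ = (⨅ i, M i).toSubmodule := by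
  rw [sumPerp, ← Submodule.iInf_orthogonal, ClosedSubmodule.toSubmodule_iInf]
  refine iInf_congr fun i => ?_
  have : CompleteSpace (M i).toSubmodule := (M i).isClosed.completeSpace_coe
  exact Submodule.orthogonal_orthogonal _

theorem topologicalClosure_sumPerp :
    (sumPerp M).topologicalClosure = (⨅ i, M i).toSubmoduleᗮ := by
  rw [← Submodule.orthogonal_orthogonal_eq_closure, orthogonal_sumPerp]

theorem sumPerp_le : sumPerp M ≤ (⨅ i, M i).toSubmoduleᗮ := by
  rw [← topologicalClosure_sumPerp]
  exact Submodule.le_topologicalClosure _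

theorem sub_orthProj_mem_sumPerp {y : H} (hy : y ∈ startSpace M) :
    y - orthProj (⨅ i, M i) y ∈ sumPerp M := by
  obtain ⟨p, hp, s, hs, rfl⟩ := Submodule.mem_sup.1 hy
  rw [map_add, orthProj_eq_self hp, orthProj_eq_zero (sumPerp_le M hs), add_zero, add_sub_cancel_left]
  exact hs

theorem cyclicOp_pow_sub_orthProj (k : ℕ) (y : H) :
    (cyclicOp M ^ k) (y - orthProj (⨅ i, M i) y) =
      (cyclicOp M ^ k) y - orthProj (⨅ i, M i) y := by
  rw [map_sub, cyclicOp_pow_apply_of_mem M (orthProj_mem _ _)]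

theorem sub_cyclicOp_pow_mem_sumPerp (k : ℕ) (x : H) :
    x - (cyclicOp M ^ k) x ∈ sumPerp M := by
  induction k with
  | zero => simp
  | succ k ih =>
    rw [pow_succ', mul_apply_eq_comp, ← sub_add_sub_cancel x ((cyclicOp M ^ k) x)]
    exact add_mem ih (sub_cyclicOp_mem_sumPerp M _)

theorem cyclicOp_pow_mem_orthogonal {x : H} (hx : x ∈ (⨅ i, M i).toSubmoduleᗮ) (k : ℕ) :
    (cyclicOp M ^ k) x ∈ (⨅ i, M i).toSubmoduleᗮ := by
  rw [← sub_sub_cancel x ((cyclicOp M ^ k) x)]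
  exact sub_mem hx (sumPerp_le M (sub_cyclicOp_pow_mem_sumPerp M k x))

/-- If some power of the cyclic operator is a strict contraction on the orthogonal complement of
the intersection, then the sum of the orthogonal complements is closed. -/
theorem isClosed_sumPerp_of_norm_le (N : ℕ) {c : ℝ} (hc0 : 0 ≤ c) (hc : c < 1)
    (h : ∀ x ∈ (⨅ i, M i).toSubmoduleᗮ, ‖(cyclicOp M ^ N) x‖ ≤ c * ‖x‖) :
    IsClosed (sumPerp M : Set H) := by
  suffices hle : (⨅ i, M i).toSubmoduleᗮ ≤ sumPerp M by
    rw [le_antisymm (sumPerp_le M) hle]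
    exact Submodule.isClosed_orthogonal _
  intro z hz
  set B : H →L[ℝ] H := cyclicOp M ^ N * (1 - orthProj (⨅ i, M i))
  have hB : ‖B‖ < 1 := by
    refine (B.opNorm_le_bound hc0 fun x => ?_).trans_lt hc
    refine (h _ (sub_orthProj_mem _ x)).trans ?_
    exact mul_le_mul_of_nonneg_left (norm_sub_orthProj_le_norm _ _) hc0
  obtain ⟨U, hU⟩ := isUnit_one_sub_of_norm_lt_one hB
  set x := (↑U⁻¹ : H →L[ℝ] H) z with hx
  have hxz : x - B x = z := by
    have : ((1 - B) * ↑U⁻¹) z = z := by rw [← hU, Units.mul_inv]; rfl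
    simpa using this
  have hBx : B x = (cyclicOp M ^ N) (x - orthProj (⨅ i, M i) x) := rfl
  -- Both `B x` and `z` are orthogonal to the intersection, so the projection of `x` onto it
  -- vanishes and `B x = T ^ N x`.
  have hP := congrArg (orthProj (⨅ i, M i)) hxz
  rw [map_sub, hBx, orthProj_eq_zero (cyclicOp_pow_mem_orthogonal M (sub_orthProj_mem _ x) N),
    sub_zero, orthProj_eq_zero hz] at hP
  rw [hP, sub_zero] at hBx
  rw [← hxz, hBx]
  exact sub_cyclicOp_pow_mem_sumPerp M N x

end SumPerp

/-! ### Power rates of real sequences and operators -/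

section PowerRates

/-- The factor 3 accommodates the index changes `k / 2` and `k - 1` for `k ≥ 2`, and `k + 1`. -/
theorem natCast_comp_rpow_isBigO {g : ℕ → ℕ} (hg : ∀ᶠ k in atTop, k ≤ 3 * g k) {p : ℝ}
    (hp : 0 ≤ p) :
    (fun k : ℕ => (g k : ℝ) ^ (-p)) =O[atTop] fun k : ℕ => (k : ℝ) ^ (-p) := by
  refine IsBigO.of_bound (3 ^ p) ?_
  filter_upwards [hg, eventually_gt_atTop 0] with k hk hk0
  have hk0' : (0 : ℝ) < k := by exact_mod_cast hk0
  have hk' : (k : ℝ) / 3 ≤ g k := by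
    have : (k : ℝ) ≤ 3 * g k := by exact_mod_cast hk
    linarith
  rw [Real.norm_of_nonneg (by positivity), Real.norm_of_nonneg (by positivity)]
  refine (Real.rpow_le_rpow_of_nonpos (by positivity) hk' (by linarith)).trans_eq ?_
  rw [Real.div_rpow hk0'.le (by norm_num), Real.rpow_neg (by norm_num : (0 : ℝ) ≤ 3), div_inv_eq_mul,
    mul_comm]

theorem mul_rpow_le_rpow_sub {s : ℝ} (hs : 0 < s) {k : ℕ} (hk : 0 < k) :
    s / 2 ^ (1 + s) * (k : ℝ) ^ (-(1 + s)) ≤ (k : ℝ) ^ (-s) - ((k + 1 : ℕ) : ℝ) ^ (-s) := by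
  have hk0 : (0 : ℝ) < k := by exact_mod_cast hk
  have hk1 : (1 : ℝ) ≤ k := by exact_mod_cast hk
  push_cast
  have h1 : s * ((k : ℝ) + 1) ^ (-(1 + s)) ≤ (k : ℝ) ^ (-s) - ((k : ℝ) + 1) ^ (-s) := by
    -- Bernoulli's inequality for `(1 + 1/k)^(1 + s)`.
    have hb := one_add_mul_self_le_rpow_one_add (s := 1 / (k : ℝ))
      (by linarith [show 0 < 1 / (k : ℝ) by positivity]) (p := 1 + s) (by linarith)
    have hb' : (k : ℝ) + 1 + s ≤ (k + 1) ^ (1 + s) * (k : ℝ) ^ (-s) := by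
      have e1 : 1 + 1 / (k : ℝ) = (k + 1) / k := by field_simp
      rw [e1, Real.div_rpow (by positivity) hk0.le] at hb
      have e2 : (k : ℝ) ^ (1 + s) = k * (k : ℝ) ^ s := by
        rw [Real.rpow_add hk0, Real.rpow_one]
      rw [e2] at hb
      have := mul_le_mul_of_nonneg_left hb hk0.le
      rw [Real.rpow_neg hk0.le]
      have hks : 0 < (k : ℝ) ^ s := by positivity
      field_simp at this ⊢
      linarith
    have hpos : (0 : ℝ) < ((k : ℝ) + 1) ^ (1 + s) := by positivity
    refine le_of_mul_le_mul_left ?_ hpos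
    have e3 : ((k : ℝ) + 1) ^ (1 + s) * ((k : ℝ) + 1) ^ (-(1 + s)) = 1 := by
      rw [← Real.rpow_add (by positivity), add_neg_cancel, Real.rpow_zero]
    have e4 : ((k : ℝ) + 1) ^ (1 + s) * ((k : ℝ) + 1) ^ (-s) = k + 1 := by
      rw [← Real.rpow_add (by positivity), add_neg_cancel_right, Real.rpow_one]
    calc ((k : ℝ) + 1) ^ (1 + s) * (s * ((k : ℝ) + 1) ^ (-(1 + s)))
        = s * (((k : ℝ) + 1) ^ (1 + s) * ((k : ℝ) + 1) ^ (-(1 + s))) := by ring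
      _ ≤ _ := by rw [mul_sub, e3, e4]; linarith
  refine le_trans ?_ h1
  have h2 : (2 * (k : ℝ)) ^ (-(1 + s)) ≤ ((k : ℝ) + 1) ^ (-(1 + s)) :=
    Real.rpow_le_rpow_of_nonpos (by positivity) (by linarith) (by linarith)
  rw [Real.mul_rpow (by norm_num) hk0.le, Real.rpow_neg (by norm_num : (0 : ℝ) ≤ 2)] at h2
  calc s / 2 ^ (1 + s) * (k : ℝ) ^ (-(1 + s))
      = s * ((2 ^ (1 + s))⁻¹ * (k : ℝ) ^ (-(1 + s))) := by ring
    _ ≤ _ := mul_le_mul_of_nonneg_left h2 hs.le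

/-- Summation of the decrements of a null sequence. -/
theorem le_rpow_of_sub_succ_le {a : ℕ → ℝ} (ha : Tendsto a atTop (𝓝 0)) {s C : ℝ} (hs : 0 < s)
    (hC : 0 ≤ C) {K : ℕ} (hK : 0 < K)
    (h : ∀ k ≥ K, a k - a (k + 1) ≤ C * (k : ℝ) ^ (-(1 + s))) {k : ℕ} (hk : K ≤ k) :
    a k ≤ C * 2 ^ (1 + s) / s * (k : ℝ) ^ (-s) := by
  set D := C * 2 ^ (1 + s) / s with hD
  have hD0 : 0 ≤ D := by positivity
  -- `D` is chosen so that the decrements of `D k^(-s)` dominate those of `a`. Then `b` increases to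
  -- its limit 0, so it is nonpositive.
  set b : ℕ → ℝ := fun j => a (k + j) - D * ((k + j : ℕ) : ℝ) ^ (-s) with hb
  have hmono : Monotone b := by
    refine monotone_nat_of_le_succ fun j => ?_
    have h1 := h (k + j) (by omega)
    have h2 := mul_le_mul_of_nonneg_left (mul_rpow_le_rpow_sub hs (k := k + j) (by omega)) hD0
    have h3 : D * (s / 2 ^ (1 + s) * ((k + j : ℕ) : ℝ) ^ (-(1 + s))) =
        C * ((k + j : ℕ) : ℝ) ^ (-(1 + s)) := by
      rw [hD]; field_simp
    rw [h3] at h2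
    simp only [hb, ← add_assoc]
    linarith
  have hlim : Tendsto b atTop (𝓝 0) := by
    have h1 : Tendsto (fun j : ℕ => k + j) atTop atTop :=
      tendsto_atTop_mono (fun j => Nat.le_add_left j k) tendsto_id
    have h2 := ((tendsto_rpow_neg_atTop hs).comp
      (tendsto_natCast_atTop_atTop (R := ℝ))).const_mul D
    simpa [hb, Function.comp_def] using (ha.comp h1).sub (h2.comp h1)
  have := hmono.ge_of_tendsto hlim 0
  simp only [hb, add_zero] at this
  linarith

theorem isBigO_of_sub_succ_le {a b : ℕ → ℝ} (ha : Tendsto a atTop (𝓝 0)) (ha0 : ∀ k, 0 ≤ a k)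
    {s : ℝ} (hs : 0 < s) (hab : ∀ k, a k - a (k + 1) ≤ b k)
    (hb : b =O[atTop] fun k : ℕ => (k : ℝ) ^ (-(1 + s))) :
    a =O[atTop] fun k : ℕ => (k : ℝ) ^ (-s) := by
  obtain ⟨C, hC0, hC⟩ := hb.exists_pos
  obtain ⟨K, hK⟩ := eventually_atTop.1 hC.bound
  refine IsBigO.of_bound (C * 2 ^ (1 + s) / s) ?_
  filter_upwards [eventually_ge_atTop (max K 1)] with k hk
  rw [Real.norm_of_nonneg (ha0 k), Real.norm_of_nonneg (by positivity)]
  refine le_rpow_of_sub_succ_le ha hs hC0.le (K := max K 1) (by simp) (fun j hj => ?_) hk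
  have := hK j ((le_max_left _ _).trans hj)
  rw [Real.norm_of_nonneg (by positivity : (0 : ℝ) ≤ (j : ℝ) ^ (-(1 + s)))] at this
  exact (hab j).trans ((le_abs_self _).trans this)

/-- The uniform boundedness principle for pointwise power rates. -/
theorem exists_norm_le_rpow_of_isBigO {E F : Type*} [NormedAddCommGroup E] [NormedSpace ℝ E]
    [CompleteSpace E] [NormedAddCommGroup F] [NormedSpace ℝ F] (G : ℕ → E →L[ℝ] F) (p : ℝ)
    (h : ∀ x, (fun k => ‖G k x‖) =O[atTop] fun k : ℕ => (k : ℝ) ^ (-p)) :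
    ∃ C, 0 ≤ C ∧ ∀ k > 0, ‖G k‖ ≤ C * (k : ℝ) ^ (-p) := by
  obtain ⟨C, hC⟩ := banach_steinhaus (g := fun k : ℕ => ((k : ℝ) ^ p) • G k) fun x => by
    have h1 : (fun k : ℕ => (k : ℝ) ^ p * ‖G k x‖) =O[atTop] fun _ : ℕ => (1 : ℝ) := by
      refine ((isBigO_refl (fun k : ℕ => (k : ℝ) ^ p) atTop).mul (h x)).trans_eventuallyEq ?_
      filter_upwards [eventually_gt_atTop 0] with k hk
      have : (0 : ℝ) < k := by exact_mod_cast hk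
      rw [← Real.rpow_add this, add_neg_cancel, Real.rpow_zero]
    obtain ⟨C, hC⟩ := isBigO_one_nat_atTop_iff.1 h1
    refine ⟨C, fun k => (le_of_eq ?_).trans (hC k)⟩
    rw [smul_apply, norm_smul, norm_mul, norm_norm]
  refine ⟨C, (norm_nonneg _).trans (hC 0), fun k hk => ?_⟩
  have hk0 : (0 : ℝ) < k := by exact_mod_cast hk
  have h2 := hC k
  rw [norm_smul, Real.norm_of_nonneg (by positivity)] at h2
  have h3 := mul_le_mul_of_nonneg_right h2 (by positivity : (0 : ℝ) ≤ (k : ℝ) ^ (-p))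
  rwa [mul_right_comm, ← Real.rpow_add hk0, add_neg_cancel, Real.rpow_zero, one_mul] at h3

end PowerRates

/-! ### Convergence rates -/

section Rates

variable {H : Type*} [NormedAddCommGroup H] [InnerProductSpace ℝ H] [CompleteSpace H]
  {m : ℕ} (M : Fin m → ClosedSubmodule ℝ H)

theorem norm_cyclicOp_pow_isBigO {w : H} (hw : w ∈ sumPerp M) :
    (fun k : ℕ => ‖(cyclicOp M ^ k) w‖) =O[atTop] fun k : ℕ => (k : ℝ) ^ (-(1 / 2) : ℝ) := by
  refine Submodule.iSup_induction _ (motive := fun w =>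
    (fun k : ℕ => ‖(cyclicOp M ^ k) w‖) =O[atTop] fun k : ℕ => (k : ℝ) ^ (-(1 / 2) : ℝ)) hw ?_ ?_ ?_
  · intro i x hx
    refine IsBigO.of_bound (√(2 * m ^ 3 * ‖x‖ ^ 2)) ?_
    filter_upwards [eventually_gt_atTop 0] with k hk
    have hk0 : (0 : ℝ) < k := by exact_mod_cast hk
    rw [norm_norm, Real.norm_of_nonneg (by positivity), Real.rpow_neg hk0.le, ← Real.sqrt_eq_rpow,
      ← Real.sqrt_inv, ← Real.sqrt_mul (by positivity)]
    refine Real.le_sqrt_of_sq_le ?_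
    rw [← div_eq_mul_inv, le_div_iff₀' hk0]
    exact mul_norm_cyclicOp_pow_sq_le_of_mem_orthogonal M hx k
  · simpa using isBigO_zero _ _
  · intro x y hx hy
    refine (IsBigO.of_bound 1 (Eventually.of_forall fun k => ?_)).trans (hx.add hy)
    rw [norm_norm, map_add, one_mul]
    exact (norm_add_le _ _).trans (le_abs_self _)

/-- Powers of `T` are contractions and tend to zero on a dense subspace of `Mᗮ`. -/
theorem tendsto_cyclicOp_pow_of_mem_orthogonal {x : H} (hx : x ∈ (⨅ i, M i).toSubmoduleᗮ) :
    Tendsto (fun k : ℕ => ‖(cyclicOp M ^ k) x‖) atTop (𝓝 0) := by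
  rw [← topologicalClosure_sumPerp] at hx
  rw [Metric.tendsto_atTop]
  intro ε hε
  obtain ⟨w, hw, hxw⟩ := Metric.mem_closure_iff.1 hx (ε / 2) (half_pos hε)
  have hlim : Tendsto (fun k : ℕ => ‖(cyclicOp M ^ k) w‖) atTop (𝓝 0) :=
    (norm_cyclicOp_pow_isBigO M hw).trans_tendsto
      ((tendsto_rpow_neg_atTop (by norm_num : (0 : ℝ) < 1 / 2)).comp tendsto_natCast_atTop_atTop)
  obtain ⟨N, hN⟩ := Metric.tendsto_atTop.1 hlim (ε / 2) (half_pos hε)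
  refine ⟨N, fun k hk => ?_⟩
  have h1 := hN k hk
  rw [dist_zero_right, norm_norm] at h1 ⊢
  have h2 : ‖(cyclicOp M ^ k) x‖ ≤ ‖(cyclicOp M ^ k) (x - w)‖ + ‖(cyclicOp M ^ k) w‖ := by
    rw [map_sub]; exact norm_le_norm_sub_add _ _
  have h3 := norm_cyclicOp_pow_apply_le M k (x - w)
  rw [dist_eq_norm] at hxw
  linarith

/-- The Ritt bound is spent on `k - k / 2 ≥ k / 2` of the steps; the remaining ones keep the decay
of `T ^ (k / 2) w`. -/
theorem mul_norm_cyclicOp_pow_sub_le_half (k : ℕ) (w : H) :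
    (k : ℝ) * ‖(cyclicOp M ^ k) (w - cyclicOp M w)‖ ≤ 2 * m * ‖(cyclicOp M ^ (k / 2)) w‖ := by
  have h1 := mul_norm_cyclicOp_pow_sub_le M (k - k / 2) ((cyclicOp M ^ (k / 2)) w)
  rw [← cyclicOp_pow_sub, ← mul_apply_eq_comp, ← pow_add, Nat.sub_add_cancel (Nat.div_le_self k 2)]
    at h1
  have h2 : (k : ℝ) ≤ 2 * (k - k / 2 : ℕ) := by exact_mod_cast (by omega : k ≤ 2 * (k - k / 2))
  have h3 := mul_le_mul_of_nonneg_right h2 (norm_nonneg ((cyclicOp M ^ k) (w - cyclicOp M w)))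
  linarith

theorem norm_cyclicOp_pow_sub_isBigO (w : H) :
    (fun k : ℕ => ‖(cyclicOp M ^ k) (w - cyclicOp M w)‖) =O[atTop]
      fun k : ℕ => (k : ℝ) ^ (-1 : ℝ) * ‖(cyclicOp M ^ (k / 2)) w‖ := by
  refine IsBigO.of_bound (2 * m) ?_
  filter_upwards [eventually_gt_atTop 0] with k hk
  have hk0 : (0 : ℝ) < k := by exact_mod_cast hk
  rw [norm_norm, norm_mul, norm_norm, Real.norm_of_nonneg (by positivity), Real.rpow_neg_one]
  have h := mul_norm_cyclicOp_pow_sub_le_half M k w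
  rw [← le_div_iff₀' hk0] at h
  refine h.trans_eq ?_
  ring

theorem norm_cyclicOp_pow_sub_isLittleO {w : H} (hw : w ∈ (⨅ i, M i).toSubmoduleᗮ) :
    (fun k : ℕ => ‖(cyclicOp M ^ k) (w - cyclicOp M w)‖) =o[atTop]
      fun k : ℕ => (k : ℝ) ^ (-1 : ℝ) := by
  refine (norm_cyclicOp_pow_sub_isBigO M w).trans_isLittleO ?_
  have h1 : (fun k : ℕ => ‖(cyclicOp M ^ (k / 2)) w‖) =o[atTop] fun _ => (1 : ℝ) :=
    (isLittleO_one_iff ℝ).2 ((tendsto_cyclicOp_pow_of_mem_orthogonal M hw).comp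
      (Nat.tendsto_div_const_atTop two_ne_zero))
  simpa using (isBigO_refl (fun k : ℕ => (k : ℝ) ^ (-1 : ℝ)) atTop).mul_isLittleO h1

theorem natCast_rpow_mul {p q r : ℝ} (h : p + q = r) :
    (fun k : ℕ => (k : ℝ) ^ p * (k : ℝ) ^ q) =ᶠ[atTop] fun k : ℕ => (k : ℝ) ^ r := by
  filter_upwards [eventually_gt_atTop 0] with k hk
  rw [← Real.rpow_add (by exact_mod_cast hk), h]

theorem norm_cyclicOp_pow_sub_isBigO_of_mem {w : H} (hw : w ∈ sumPerp M) :
    (fun k : ℕ => ‖(cyclicOp M ^ k) (w - cyclicOp M w)‖) =O[atTop]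
      fun k : ℕ => (k : ℝ) ^ (-(3 / 2) : ℝ) := by
  refine (norm_cyclicOp_pow_sub_isBigO M w).trans ?_
  have h1 : (fun k : ℕ => ‖(cyclicOp M ^ (k / 2)) w‖) =O[atTop]
      fun k : ℕ => (k : ℝ) ^ (-(1 / 2) : ℝ) := by
    refine ((norm_cyclicOp_pow_isBigO M hw).comp_tendsto
      (Nat.tendsto_div_const_atTop two_ne_zero)).trans ?_
    refine natCast_comp_rpow_isBigO (g := fun k => k / 2) ?_ (by norm_num)
    filter_upwards [eventually_ge_atTop 2] with k hk
    omega
  exact ((isBigO_refl (fun k : ℕ => (k : ℝ) ^ (-1 : ℝ)) atTop).mul h1).trans_eventuallyEq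
    (natCast_rpow_mul (by norm_num))

theorem sub_cyclicOp_sub_orthProj (y : H) :
    (y - orthProj (⨅ i, M i) y) - cyclicOp M (y - orthProj (⨅ i, M i) y) = y - cyclicOp M y := by
  rw [map_sub, cyclicOp_apply_of_mem M (ClosedSubmodule.mem_iInf.1 (orthProj_mem _ y))]
  abel

theorem norm_cyclicSeq_succ_sub (y : H) (k : ℕ) :
    ‖cyclicSeq M y (k + 1) - cyclicSeq M y k‖ =
      ‖(cyclicOp M ^ k) (y - cyclicOp M y)‖ := by
  rw [cyclicOp_pow_sub, norm_sub_rev, cyclicSeq, cyclicSeq, pow_succ', mul_apply_eq_comp]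

theorem norm_cyclicSeq_sub_pred (y : H) :
    (fun k : ℕ => ‖cyclicSeq M y k - cyclicSeq M y (k - 1)‖) =ᶠ[atTop]
      (fun k : ℕ => ‖(cyclicOp M ^ k) (y - cyclicOp M y)‖) ∘ fun k => k - 1 := by
  -- Truncated subtraction matters only at `k = 0`.
  filter_upwards [eventually_gt_atTop 0] with k hk
  obtain ⟨j, rfl⟩ := Nat.exists_eq_succ_of_ne_zero hk.ne'
  exact norm_cyclicSeq_succ_sub M y j

theorem pred_rpow_isBigO {p : ℝ} (hp : 0 ≤ p) :
    (fun k : ℕ => ((k - 1 : ℕ) : ℝ) ^ (-p)) =O[atTop] fun k : ℕ => (k : ℝ) ^ (-p) := by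
  refine natCast_comp_rpow_isBigO (g := fun k => k - 1) ?_ hp
  filter_upwards [eventually_ge_atTop 2] with k hk
  omega

theorem sumSqDist_sub_of_mem {p : H} (hp : p ∈ ⨅ i, M i) (x : H) :
    sumSqDist M (x - p) = sumSqDist M x := by
  refine Finset.sum_congr rfl fun i _ => ?_
  rw [map_sub, orthProj_eq_self (ClosedSubmodule.mem_iInf.1 hp i), sub_sub_sub_cancel_right]

theorem sumSqDist_cyclicSeq_isBigO (y : H) :
    (fun k : ℕ => sumSqDist M (cyclicSeq M y k)) =O[atTop] fun k : ℕ =>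
      ‖(cyclicOp M ^ k) (y - cyclicOp M y)‖ *
        ‖(cyclicOp M ^ k) (y - orthProj (⨅ i, M i) y)‖ := by
  refine IsBigO.of_bound (2 * m ^ 2) (Eventually.of_forall fun k => ?_)
  rw [Real.norm_of_nonneg (sumSqDist_nonneg _ _), Real.norm_of_nonneg (by positivity)]
  have h := sumSqDist_cyclicOp_pow_le M k (y - orthProj (⨅ i, M i) y)
  rw [sub_cyclicOp_sub_orthProj] at h
  refine le_trans (le_of_eq ?_) h
  rw [cyclicOp_pow_sub_orthProj, sumSqDist_sub_of_mem M (orthProj_mem _ y)]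
  rfl

theorem natCast_rpow_sq {p q : ℝ} (h : 2 * p = q) :
    (fun k : ℕ => (k : ℝ) ^ q) =ᶠ[atTop] (fun k : ℕ => (k : ℝ) ^ p) ^ 2 := by
  filter_upwards [] with k
  rw [Pi.pow_apply, ← Real.rpow_mul_natCast (Nat.cast_nonneg k), ← h]
  congr 1
  push_cast
  ring

theorem avgDist_sq_isBigO (y : H) :
    ((fun k : ℕ => avgDist M (cyclicSeq M y k)) ^ 2) =O[atTop]
      fun k : ℕ => sumSqDist M (cyclicSeq M y k) := by
  refine IsBigO.of_bound (1 / m) (Eventually.of_forall fun k => ?_)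
  rw [Pi.pow_apply, avgDist_sq, norm_mul, Real.norm_of_nonneg (by positivity : (0 : ℝ) ≤ 1 / m)]

theorem sumSqDist_isBigO_avgDist_sq (y : H) :
    (fun k : ℕ => sumSqDist M (cyclicSeq M y k)) =O[atTop]
      ((fun k : ℕ => avgDist M (cyclicSeq M y k)) ^ 2) := by
  refine IsBigO.of_bound m (Eventually.of_forall fun k => ?_)
  rw [Pi.pow_apply, avgDist_sq, norm_mul, Real.norm_of_nonneg (by positivity : (0 : ℝ) ≤ 1 / m)]
  rcases m.eq_zero_or_pos with rfl | hm
  · simp [sumSqDist]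
  · have : (m : ℝ) ≠ 0 := by positivity
    rw [← mul_assoc, mul_one_div_cancel this, one_mul]

theorem sumSqDist_isBigO_of_avgDist {y : H} {p q : ℝ} (hpq : 2 * p = q)
    (h : (fun k : ℕ => avgDist M (cyclicSeq M y k)) =O[atTop] fun k : ℕ => (k : ℝ) ^ p) :
    (fun k : ℕ => sumSqDist M (cyclicSeq M y k)) =O[atTop] fun k : ℕ => (k : ℝ) ^ q :=
  (sumSqDist_isBigO_avgDist_sq M y).trans ((h.pow 2).trans_eventuallyEq (natCast_rpow_sq hpq).symm)

theorem cyclicSeq_sub_isLittleO (y : H) :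
    (fun k : ℕ => ‖cyclicSeq M y k - cyclicSeq M y (k - 1)‖) =o[atTop]
      fun k : ℕ => (k : ℝ) ^ (-1 : ℝ) := by
  refine (norm_cyclicSeq_sub_pred M y).trans_isLittleO ?_
  rw [← sub_cyclicOp_sub_orthProj]
  exact ((norm_cyclicOp_pow_sub_isLittleO M (sub_orthProj_mem _ y)).comp_tendsto
    (tendsto_sub_atTop_nat 1)).trans_isBigO (pred_rpow_isBigO zero_le_one)

theorem avgDist_isLittleO (y : H) :
    (fun k : ℕ => avgDist M (cyclicSeq M y k)) =o[atTop]
      fun k : ℕ => (k : ℝ) ^ (-(1 / 2) : ℝ) := by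
  refine IsLittleO.of_pow (n := 2) ?_ two_ne_zero
  refine IsLittleO.trans_eventuallyEq ?_ (natCast_rpow_sq (q := -1) (by norm_num))
  refine ((avgDist_sq_isBigO M y).trans (sumSqDist_cyclicSeq_isBigO M y)).trans_isLittleO ?_
  have h1 := norm_cyclicOp_pow_sub_isLittleO M (sub_orthProj_mem _ y)
  rw [sub_cyclicOp_sub_orthProj] at h1
  have h2 : (fun k : ℕ => ‖(cyclicOp M ^ k) (y - orthProj (⨅ i, M i) y)‖) =O[atTop]
      fun _ => (1 : ℝ) :=
    (tendsto_cyclicOp_pow_of_mem_orthogonal M (sub_orthProj_mem _ y)).isBigO_one ℝ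
  simpa using h1.mul_isBigO h2

variable {M}

theorem cyclicSeq_sub_orthProj_isBigO {y : H} (hy : y ∈ startSpace M) :
    (fun k : ℕ => ‖cyclicSeq M y k - orthProj (⨅ i, M i) y‖) =O[atTop]
      fun k : ℕ => (k : ℝ) ^ (-(1 / 2) : ℝ) := by
  simpa only [cyclicSeq, cyclicOp_pow_sub_orthProj] using
    norm_cyclicOp_pow_isBigO M (sub_orthProj_mem_sumPerp M hy)

theorem cyclicSeq_sub_isBigO {y : H} (hy : y ∈ startSpace M) :
    (fun k : ℕ => ‖cyclicSeq M y k - cyclicSeq M y (k - 1)‖) =O[atTop]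
      fun k : ℕ => (k : ℝ) ^ (-(3 / 2) : ℝ) := by
  refine (norm_cyclicSeq_sub_pred M y).trans_isBigO ?_
  rw [← sub_cyclicOp_sub_orthProj]
  exact ((norm_cyclicOp_pow_sub_isBigO_of_mem M (sub_orthProj_mem_sumPerp M hy)).comp_tendsto
    (tendsto_sub_atTop_nat 1)).trans (pred_rpow_isBigO (by norm_num))

theorem avgDist_isBigO {y : H} (hy : y ∈ startSpace M) :
    (fun k : ℕ => avgDist M (cyclicSeq M y k)) =O[atTop] fun k : ℕ => (k : ℝ) ^ (-1 : ℝ) := by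
  refine IsBigO.of_pow (n := 2) two_ne_zero ?_
  refine IsBigO.trans_eventuallyEq ?_ (natCast_rpow_sq (q := -2) (by norm_num))
  refine ((avgDist_sq_isBigO M y).trans (sumSqDist_cyclicSeq_isBigO M y)).trans ?_
  have hw := sub_orthProj_mem_sumPerp M hy
  have h1 := norm_cyclicOp_pow_sub_isBigO_of_mem M hw
  rw [sub_cyclicOp_sub_orthProj] at h1
  exact (h1.mul (norm_cyclicOp_pow_isBigO M hw)).trans_eventuallyEq
    (natCast_rpow_mul (by norm_num))

end Rates

/-! ### Faster rates force closedness -/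

section Optimality

variable {H : Type*} [NormedAddCommGroup H] [InnerProductSpace ℝ H] [CompleteSpace H]
  {m : ℕ} {M : Fin m → ClosedSubmodule ℝ H}

theorem isClosed_sumPerp_of_tendsto {b : ℕ → ℝ} (hb : Tendsto b atTop (𝓝 0))
    (hb0 : ∀ k, 0 ≤ b k)
    (h : ∀ x ∈ (⨅ i, M i).toSubmoduleᗮ, ∀ k : ℕ, 0 < k → ‖(cyclicOp M ^ k) x‖ ≤ b k * ‖x‖) :
    IsClosed (sumPerp M : Set H) := by
  obtain ⟨N, hN, hN0⟩ := ((hb.eventually_lt_const zero_lt_one).and (eventually_gt_atTop 0)).exists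
  exact isClosed_sumPerp_of_norm_le M N (hb0 N) hN fun x hx => h x hx N hN0

theorem tendsto_const_mul_natCast_rpow_neg (C : ℝ) {s : ℝ} (hs : 0 < s) :
    Tendsto (fun k : ℕ => C * (k : ℝ) ^ (-s)) atTop (𝓝 0) := by
  simpa using ((tendsto_rpow_neg_atTop hs).comp
    (tendsto_natCast_atTop_atTop (R := ℝ))).const_mul C

/-- A uniform rate for the distances to the subspaces forces the sum of the orthogonal
complements to be closed. -/
theorem isClosed_sumPerp_of_norm_one_sub_mul_le {ε : ℝ} (hε : 0 < ε)
    (h : ∀ i, ∃ C, 0 ≤ C ∧ ∀ k : ℕ, 0 < k →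
      ‖(1 - orthProj (M i)) * cyclicOp M ^ k‖ ≤ C * (k : ℝ) ^ (-(1 / 2 + ε))) :
    IsClosed (sumPerp M : Set H) := by
  choose C hC0 hC using h
  set D := 4 * ∑ i, C i ^ 2 with hD
  have hD0 : 0 ≤ D := by positivity
  set E := D * 2 ^ (1 + 2 * ε) / (2 * ε) with hE
  have hE0 : 0 ≤ E := by positivity
  refine isClosed_sumPerp_of_tendsto (b := fun k => √(E * (k : ℝ) ^ (-(2 * ε))))
    ?_ (fun k => Real.sqrt_nonneg _) fun x hx k hk => ?_
  · simpa using (tendsto_const_mul_natCast_rpow_neg E (by positivity : 0 < 2 * ε)).sqrt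
  · have hlim : Tendsto (fun k : ℕ => ‖(cyclicOp M ^ k) x‖ ^ 2) atTop (𝓝 0) := by
      simpa using (tendsto_cyclicOp_pow_of_mem_orthogonal M hx).pow 2
    -- Squared norms drop by at most `4 D (T ^ k x)`, which is uniformly of order `k^(-(1 + 2ε))`
    -- and therefore summable.
    have key : ∀ k : ℕ, 1 ≤ k → ‖(cyclicOp M ^ k) x‖ ^ 2 - ‖(cyclicOp M ^ (k + 1)) x‖ ^ 2 ≤
        D * ‖x‖ ^ 2 * (k : ℝ) ^ (-(1 + 2 * ε)) := by
      intro k hk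
      rw [pow_succ' (cyclicOp M) k, mul_apply_eq_comp]
      refine (norm_sq_sub_le_sumSqDist M _).trans ?_
      have hi : ∀ i, ‖(cyclicOp M ^ k) x - orthProj (M i) ((cyclicOp M ^ k) x)‖ ^ 2 ≤
          C i ^ 2 * (‖x‖ ^ 2 * (k : ℝ) ^ (-(1 + 2 * ε))) := by
        intro i
        have h1 : ‖(cyclicOp M ^ k) x - orthProj (M i) ((cyclicOp M ^ k) x)‖ ≤
            C i * (k : ℝ) ^ (-(1 / 2 + ε)) * ‖x‖ :=
          ((1 - orthProj (M i)) * cyclicOp M ^ k).le_of_opNorm_le (hC i k hk) x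
        refine (pow_le_pow_left₀ (norm_nonneg _) h1 2).trans_eq ?_
        have h2 : ((k : ℝ) ^ (-(1 / 2 + ε))) ^ 2 = (k : ℝ) ^ (-(1 + 2 * ε)) := by
          rw [← Real.rpow_mul_natCast (Nat.cast_nonneg k)]
          congr 1
          push_cast
          ring
        rw [mul_pow, mul_pow, h2]
        ring
      have h3 := Finset.sum_le_sum fun i (_ : i ∈ Finset.univ) => hi i
      rw [← Finset.sum_mul] at h3
      rw [hD, sumSqDist]
      linarith
    have := le_rpow_of_sub_succ_le hlim (by positivity : 0 < 2 * ε)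
      (by positivity : 0 ≤ D * ‖x‖ ^ 2) zero_lt_one key hk
    refine abs_le_of_sq_le_sq' ?_ (by positivity) |>.2
    rw [mul_pow, Real.sq_sqrt (by positivity)]
    refine this.trans_eq ?_
    rw [hE]
    ring

theorem isClosed_sumPerp_of_cyclicSeq_sub_isBigO {ε : ℝ} (hε : 0 < ε)
    (h : ∀ y, (fun k : ℕ => ‖cyclicSeq M y k - cyclicSeq M y (k - 1)‖) =O[atTop]
      fun k : ℕ => (k : ℝ) ^ (-(1 + ε))) :
    IsClosed (sumPerp M : Set H) := by
  have h1 : ∀ y, (fun k : ℕ => ‖(cyclicOp M ^ k * (1 - cyclicOp M)) y‖) =O[atTop]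
      fun k : ℕ => (k : ℝ) ^ (-(1 + ε)) := by
    intro y
    have h2 := ((h y).comp_tendsto (tendsto_add_atTop_nat 1))
    refine (IsBigO.trans ?_ h2).trans ?_
    · refine isBigO_of_le _ fun k => ?_
      simp only [Function.comp_def, Nat.add_sub_cancel]
      rw [norm_cyclicSeq_succ_sub]
      rfl
    · refine natCast_comp_rpow_isBigO (g := fun k => k + 1) ?_ (by positivity)
      exact Eventually.of_forall fun k => by omega
  obtain ⟨C, hC0, hC⟩ := exists_norm_le_rpow_of_isBigO _ _ h1
  refine isClosed_sumPerp_of_tendsto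
    (tendsto_const_mul_natCast_rpow_neg (C * 2 ^ (1 + ε) / ε) hε) (fun k => by positivity)
    fun x hx k hk => ?_
  have key : ∀ k : ℕ, 1 ≤ k → ‖(cyclicOp M ^ k) x‖ - ‖(cyclicOp M ^ (k + 1)) x‖ ≤
      C * ‖x‖ * (k : ℝ) ^ (-(1 + ε)) := by
    intro k hk
    refine (norm_sub_norm_le _ _).trans ?_
    rw [pow_succ' (cyclicOp M) k, mul_apply_eq_comp, ← cyclicOp_pow_sub]
    refine ((cyclicOp M ^ k * (1 - cyclicOp M)).le_of_opNorm_le (hC k hk) x).trans_eq ?_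
    ring
  refine (le_rpow_of_sub_succ_le (tendsto_cyclicOp_pow_of_mem_orthogonal M hx) hε
    (by positivity) zero_lt_one key hk).trans_eq ?_
  ring

theorem isClosed_sumPerp_of_avgDist_isBigO {ε : ℝ} (hε : 0 < ε)
    (h : ∀ y, (fun k : ℕ => avgDist M (cyclicSeq M y k)) =O[atTop]
      fun k : ℕ => (k : ℝ) ^ (-(1 / 2 + ε))) :
    IsClosed (sumPerp M : Set H) := by
  refine isClosed_sumPerp_of_norm_one_sub_mul_le hε fun i =>
    exists_norm_le_rpow_of_isBigO _ _ fun x => ?_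
  refine IsBigO.of_pow (n := 2) two_ne_zero ?_
  refine (IsBigO.trans ?_ (sumSqDist_isBigO_of_avgDist M rfl (h x))).trans_eventuallyEq
    (natCast_rpow_sq rfl)
  refine isBigO_of_le _ fun k => ?_
  rw [Pi.pow_apply, Real.norm_of_nonneg (by positivity),
    Real.norm_of_nonneg (sumSqDist_nonneg _ _)]
  exact norm_sub_sq_le_sumSqDist M i _

/-- The range of `1 - P_i` lies in `Y`, so the rate becomes uniform for `T ^ k (1 - P_i)`. Its
adjoint is `(1 - P_i) S ^ k` with `S` the reversed product, to which the distance criterion applies.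
-/
theorem isClosed_sumPerp_of_cyclicSeq_sub_orthProj_isBigO {ε : ℝ} (hε : 0 < ε)
    (h : ∀ y ∈ startSpace M, (fun k : ℕ => ‖cyclicSeq M y k - orthProj (⨅ i, M i) y‖) =O[atTop]
      fun k : ℕ => (k : ℝ) ^ (-(1 / 2 + ε))) :
    IsClosed (sumPerp M : Set H) := by
  rw [← sumPerp_comp_rev]
  refine isClosed_sumPerp_of_norm_one_sub_mul_le hε fun i => ?_
  obtain ⟨C, hC0, hC⟩ := exists_norm_le_rpow_of_isBigO
    (fun k => cyclicOp M ^ k * (1 - orthProj (M i.rev))) _ fun x => by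
      have hw : x - orthProj (M i.rev) x ∈ sumPerp M :=
        Submodule.mem_iSup_of_mem i.rev (sub_orthProj_mem _ x)
      have h1 := h _ (Submodule.mem_sup_right hw)
      simp only [orthProj_eq_zero (sumPerp_le M hw), sub_zero] at h1
      exact h1
  refine ⟨C, hC0, fun k hk => ?_⟩
  rw [← norm_star, star_mul, star_pow, star_cyclicOp, star_sub, star_one,
    (orthProj_isSelfAdjoint _).star_eq]
  simpa only [Fin.rev_rev] using hC k hk

theorem tendsto_cyclicSeq_sub_orthProj (y : H) :
    Tendsto (fun k : ℕ => ‖cyclicSeq M y k - orthProj (⨅ i, M i) y‖) atTop (𝓝 0) := by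
  simpa only [cyclicSeq, cyclicOp_pow_sub_orthProj] using
    tendsto_cyclicOp_pow_of_mem_orthogonal M (sub_orthProj_mem _ y)

theorem cyclicSeq_sub_orthProj_isBigO_of_cyclicSeq_sub {y : H} {s : ℝ} (hs : 0 < s)
    (h : (fun k : ℕ => ‖cyclicSeq M y k - cyclicSeq M y (k - 1)‖) =O[atTop]
      fun k : ℕ => (k : ℝ) ^ (-(1 + s))) :
    (fun k : ℕ => ‖cyclicSeq M y k - orthProj (⨅ i, M i) y‖) =O[atTop]
      fun k : ℕ => (k : ℝ) ^ (-s) := by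
  refine isBigO_of_sub_succ_le (tendsto_cyclicSeq_sub_orthProj y) (fun k => norm_nonneg _) hs
    (b := fun k => ‖cyclicSeq M y (k + 1) - cyclicSeq M y k‖) (fun k => ?_) ?_
  · refine (norm_sub_norm_le _ _).trans_eq ?_
    rw [sub_sub_sub_cancel_right, norm_sub_rev]
  · refine (h.comp_tendsto (tendsto_add_atTop_nat 1)).trans ?_
    refine natCast_comp_rpow_isBigO (g := fun k => k + 1) ?_ (by positivity)
    exact Eventually.of_forall fun k => by omega

/-- Squared errors have decrements at most `4 D`, of order `k^(-(1 + 2s))`; summation and a square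
root give `k^(-s)`. -/
theorem cyclicSeq_sub_orthProj_isBigO_of_avgDist {y : H} {s : ℝ} (hs : 0 < s)
    (h : (fun k : ℕ => avgDist M (cyclicSeq M y k)) =O[atTop]
      fun k : ℕ => (k : ℝ) ^ (-(1 / 2 + s))) :
    (fun k : ℕ => ‖cyclicSeq M y k - orthProj (⨅ i, M i) y‖) =O[atTop]
      fun k : ℕ => (k : ℝ) ^ (-s) := by
  refine IsBigO.of_pow (n := 2) two_ne_zero ?_
  refine IsBigO.trans_eventuallyEq ?_ (natCast_rpow_sq (q := -(2 * s)) (by ring))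
  refine isBigO_of_sub_succ_le (b := fun k => 4 * sumSqDist M (cyclicSeq M y k)) ?_
    (fun k => sq_nonneg _) (by positivity) (fun k => ?_)
    ((sumSqDist_isBigO_of_avgDist M (by ring) h).const_mul_left 4)
  · simpa using (tendsto_cyclicSeq_sub_orthProj (M := M) y).pow 2
  · have h1 := norm_sq_sub_le_sumSqDist M (cyclicSeq M y k - orthProj (⨅ i, M i) y)
    rw [sumSqDist_sub_of_mem M (orthProj_mem _ y), map_sub,
      cyclicOp_apply_of_mem M (ClosedSubmodule.mem_iInf.1 (orthProj_mem _ y))] at h1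
    have h2 : cyclicSeq M y (k + 1) = cyclicOp M (cyclicSeq M y k) := by
      rw [cyclicSeq, pow_succ', mul_apply_eq_comp]; rfl
    rwa [h2]

end Optimality


theorem theorem4p3 {H : Type*} [NormedAddCommGroup H] [InnerProductSpace ℝ H] [CompleteSpace H]
    (m : ℕ) (hm : 1 ≤ m) (M : Fin m → ClosedSubmodule ℝ H) :
    -- rates for every starting point
    (∀ y₀ : H,
      ((fun k : ℕ => ‖cyclicSeq M y₀ k - cyclicSeq M y₀ (k - 1)‖)
        =o[atTop] fun k : ℕ => (k : ℝ) ^ (-1 : ℝ)) ∧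
      ((fun k : ℕ => avgDist M (cyclicSeq M y₀ k))
        =o[atTop] fun k : ℕ => (k : ℝ) ^ (-(1 / 2) : ℝ))) ∧
    -- rates for starting points in `Y`
    (∀ y₀ ∈ startSpace M,
      ((fun k : ℕ => ‖cyclicSeq M y₀ k - orthProj (⨅ i, M i) y₀‖)
        =O[atTop] fun k : ℕ => (k : ℝ) ^ (-(1 / 2) : ℝ)) ∧
      ((fun k : ℕ => ‖cyclicSeq M y₀ k - cyclicSeq M y₀ (k - 1)‖)
        =O[atTop] fun k : ℕ => (k : ℝ) ^ (-(3 / 2) : ℝ)) ∧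
      ((fun k : ℕ => avgDist M (cyclicSeq M y₀ k))
        =O[atTop] fun k : ℕ => (k : ℝ) ^ (-1 : ℝ))) ∧
    -- optimality of each of the five rates
    (¬ IsClosed (sumPerp M : Set H) → ∀ ε : ℝ, 0 < ε →
      (∃ y₀ : H, ¬ ((fun k : ℕ => ‖cyclicSeq M y₀ k - cyclicSeq M y₀ (k - 1)‖)
        =O[atTop] fun k : ℕ => (k : ℝ) ^ (-(1 + ε)))) ∧
      (∃ y₀ : H, ¬ ((fun k : ℕ => avgDist M (cyclicSeq M y₀ k))
        =O[atTop] fun k : ℕ => (k : ℝ) ^ (-(1 / 2 + ε)))) ∧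
      (∃ y₀ ∈ startSpace M, ¬ ((fun k : ℕ => ‖cyclicSeq M y₀ k - orthProj (⨅ i, M i) y₀‖)
        =O[atTop] fun k : ℕ => (k : ℝ) ^ (-(1 / 2 + ε)))) ∧
      (∃ y₀ ∈ startSpace M, ¬ ((fun k : ℕ => ‖cyclicSeq M y₀ k - cyclicSeq M y₀ (k - 1)‖)
        =O[atTop] fun k : ℕ => (k : ℝ) ^ (-(3 / 2 + ε)))) ∧
      (∃ y₀ ∈ startSpace M, ¬ ((fun k : ℕ => avgDist M (cyclicSeq M y₀ k))
        =O[atTop] fun k : ℕ => (k : ℝ) ^ (-(1 + ε))))) := by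

  refine ⟨fun y => ⟨cyclicSeq_sub_isLittleO M y, avgDist_isLittleO M y⟩,
    fun y hy => ⟨cyclicSeq_sub_orthProj_isBigO hy, cyclicSeq_sub_isBigO hy, avgDist_isBigO hy⟩,
    fun hcl ε hε => ⟨?_, ?_, ?_, ?_, ?_⟩⟩ <;> by_contra! h <;> refine hcl ?_
  · exact isClosed_sumPerp_of_cyclicSeq_sub_isBigO hε h
  · exact isClosed_sumPerp_of_avgDist_isBigO hε h
  · exact isClosed_sumPerp_of_cyclicSeq_sub_orthProj_isBigO hε h
  -- Summation loses one power: `3/2 + ε = 1 + (1/2 + ε)`.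
  · refine isClosed_sumPerp_of_cyclicSeq_sub_orthProj_isBigO hε fun y hy =>
      cyclicSeq_sub_orthProj_isBigO_of_cyclicSeq_sub (by positivity) ?_
    convert h y hy using 4
    ring
  -- Passing from distances to the error loses half a power: `1 + ε = 1/2 + (1/2 + ε)`.
  · refine isClosed_sumPerp_of_cyclicSeq_sub_orthProj_isBigO hε fun y hy =>
      cyclicSeq_sub_orthProj_isBigO_of_avgDist (by positivity) ?_
    convert h y hy using 4
    ring
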